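/- For a probability space and $0<\varepsilon<1$, let $X_1,X_2,\dots$ and $Y_1,Y_2,\dots$ be two independent sequences of i.i.d. $\{0,1\}$-valued random variables with $P(X_i=1)=P(Y_i=1)=\varepsilon$. Let $L_n$ be the length of the longest common subsequence of $X_1\cdots X_n$ and $Y_1\cdots Y_n$, that is, the largest $k\ge 0$ for which there are indices $1\le i_1<\dots<i_k\le n$ and $1\le j_1<\dots<j_k\le n$ with $X_{i_a}=Y_{j_a}$ for $a=1,\dots,k$. Theorem 2.1. There is $\varepsilon_0\in(0,\tfrac12]$ such that for every $0<\varepsilon<\varepsilon_0$ there is a constant $c=c(\varepsilon)>0$, depending only on $\varepsilon$ and not on $n$, with $$\operatorname{Var}[L_n]\ \ge\ c\,n\qquad\text{for all } n .$$ Together with Steele's upper bound $\operatorname{Var}[L_n]\le 2\varepsilon(1-\varepsilon)\,n$ for all $n$, this gives, for every $0<\varepsilon<\varepsilon_0$, $\operatorname{Var}[L_n]=\Theta(n)$ and $\sqrt{\operatorname{Var}[L_n]}=\Theta(\sqrt n)$ as $n\to\infty$. -/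

import Mathlib

open MeasureTheory ProbabilityTheory Filter Asymptotics

/-- `k` is the length of some common subsequence of the strings `x` and `y`: there are indices
`i₁ < ⋯ < i_k` and `j₁ < ⋯ < j_k` with `x_{i_a} = y_{j_a}` for every `a`. -/
def HasCommonSubseq {A : Type*} {n : ℕ} (x y : Fin n → A) (k : ℕ) : Prop :=
  ∃ i j : Fin k → Fin n, StrictMono i ∧ StrictMono j ∧ ∀ a, x (i a) = y (j a)

/-- The length of the longest common subsequence of `x` and `y`. -/
noncomputable def lcsLength {A : Type*} {n : ℕ} (x y : Fin n → A) : ℕ :=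
  sSup {k : ℕ | HasCommonSubseq x y k}

/-- The supremum in the definition of `lcsLength` is attained: it is a maximum. -/
theorem isGreatest_lcsLength {A : Type*} {n : ℕ} (x y : Fin n → A) :
    IsGreatest {k : ℕ | HasCommonSubseq x y k} (lcsLength x y) := by
  have hb : BddAbove {k : ℕ | HasCommonSubseq x y k} := by
    refine ⟨n, ?_⟩
    rintro k ⟨i, -, hi, -, -⟩
    simpa using Fintype.card_le_of_injective i hi.injective
  have h0 : (0 : ℕ) ∈ {k : ℕ | HasCommonSubseq x y k} :=
    ⟨Fin.elim0, Fin.elim0, fun a => a.elim0, fun a => a.elim0, fun a => a.elim0⟩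
  exact ⟨Nat.sSup_mem ⟨0, h0⟩ hb, fun k hk => le_csSup hb hk⟩

/-- `X` and `Y` are two independent sequences of i.i.d. Bernoulli variables with parameter `ε`
on the probability space `(Ω, P)`. The letter `1` is `true`, the letter `0` is `false`, and the
sequences are indexed from `0`. -/
structure IndepBernoulliSeqs {Ω : Type*} [MeasurableSpace Ω] (P : Measure Ω) (ε : ℝ)
    (X Y : ℕ → Ω → Bool) : Prop where
  measurable_left : ∀ i, Measurable (X i)
  measurable_right : ∀ i, Measurable (Y i)
  prob_left : ∀ i, P.real {ω | X i ω = true} = ε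
  prob_right : ∀ i, P.real {ω | Y i ω = true} = ε
  indep_left : iIndepFun X P
  indep_right : iIndepFun Y P
  indep : IndepFun (fun ω i => X i ω) (fun ω i => Y i ω) P

/-- The random variable `L_n`: the length of the longest common subsequence of the first `n`
letters of `X` and the first `n` letters of `Y`. -/
noncomputable def lcsVar {Ω : Type*} (X Y : ℕ → Ω → Bool) (n : ℕ) (ω : Ω) : ℝ :=
  (lcsLength (fun i : Fin n => X i ω) (fun i : Fin n => Y i ω) : ℝ)

section Lists

variable {α : Type*}

/-- The length of the longest common sublist of two lists. -/
noncomputable def listLcs (x y : List α) : ℕ :=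
  sSup {k | ∃ w : List α, w.Sublist x ∧ w.Sublist y ∧ w.length = k}

theorem bddAbove_common_sublist_length (x y : List α) :
    BddAbove {k | ∃ w : List α, w.Sublist x ∧ w.Sublist y ∧ w.length = k} := by
  refine ⟨x.length, ?_⟩
  rintro k ⟨w, hx, -, rfl⟩
  exact hx.length_le

theorem length_le_listLcs {w x y : List α} (hx : w.Sublist x) (hy : w.Sublist y) :
    w.length ≤ listLcs x y :=
  le_csSup (bddAbove_common_sublist_length x y) ⟨w, hx, hy, rfl⟩

theorem exists_length_eq_listLcs (x y : List α) :
    ∃ w : List α, w.Sublist x ∧ w.Sublist y ∧ w.length = listLcs x y :=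
  Nat.sSup_mem (s := {k | ∃ w : List α, w.Sublist x ∧ w.Sublist y ∧ w.length = k})
    ⟨0, [], List.nil_sublist _, List.nil_sublist _, rfl⟩ (bddAbove_common_sublist_length x y)

theorem listLcs_mono {x x' y y' : List α} (hx : x.Sublist x') (hy : y.Sublist y') :
    listLcs x y ≤ listLcs x' y' := by
  obtain ⟨w, h1, h2, h3⟩ := exists_length_eq_listLcs x y
  exact h3 ▸ length_le_listLcs (h1.trans hx) (h2.trans hy)

theorem listLcs_comm (x y : List α) : listLcs x y = listLcs y x := by
  unfold listLcs
  congr 1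
  ext k
  constructor <;> rintro ⟨w, h1, h2, h3⟩ <;> exact ⟨w, h2, h1, h3⟩

theorem listLcs_nil_left (y : List α) : listLcs [] y = 0 := by
  obtain ⟨w, h1, -, h3⟩ := exists_length_eq_listLcs [] y
  rw [← h3, List.sublist_nil.1 h1]; rfl

theorem listLcs_nil_right (x : List α) : listLcs x [] = 0 := by
  rw [listLcs_comm, listLcs_nil_left]

theorem listLcs_add_one_le (a : α) (x y : List α) :
    listLcs x y + 1 ≤ listLcs (a :: x) (a :: y) := by
  obtain ⟨w, h1, h2, h3⟩ := exists_length_eq_listLcs x y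
  have := length_le_listLcs (h1.cons_cons a) (h2.cons_cons a)
  simp only [List.length_cons] at this
  omega

theorem listLcs_cons_cons_cases (a b : α) (x y : List α) :
    listLcs (a :: x) (b :: y) ≤ listLcs x (b :: y) ∨
      listLcs (a :: x) (b :: y) ≤ listLcs (a :: x) y ∨
        (a = b ∧ listLcs (a :: x) (b :: y) ≤ listLcs x y + 1) := by
  obtain ⟨w, h1, h2, h3⟩ := exists_length_eq_listLcs (a :: x) (b :: y)
  rw [← h3]
  cases h1 with
  | cons _ h1 => exact Or.inl (length_le_listLcs h1 h2)
  | cons_cons _ h1' =>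
    cases h2 with
    | cons _ h2 => exact Or.inr (Or.inl (length_le_listLcs (h1'.cons_cons a) h2))
    | cons_cons _ h2 => exact Or.inr (Or.inr ⟨rfl, by simpa using length_le_listLcs h1' h2⟩)

theorem listLcs_append_cons_le (x₁ x₂ y : List α) (b : α) :
    listLcs (x₁ ++ b :: x₂) y ≤ listLcs (x₁ ++ x₂) y + 1 := by
  obtain ⟨w, h1, h2, h3⟩ := exists_length_eq_listLcs (x₁ ++ b :: x₂) y
  obtain ⟨w₁, w₂, rfl, h4, h5⟩ := List.sublist_append_iff.1 h1
  rw [← h3]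
  cases h5 with
  | cons _ h => exact (length_le_listLcs (h4.append h) h2).trans (Nat.le_succ _)
  | @cons_cons v _ _ h =>
    have := length_le_listLcs (h4.append h)
      (((List.sublist_cons_self b v).append_left w₁).trans h2)
    simp only [List.length_append, List.length_cons] at this ⊢
    omega

theorem listLcs_substitution_le (x₁ x₂ y : List α) (b b' : α) :
    listLcs (x₁ ++ b :: x₂) y ≤ listLcs (x₁ ++ b' :: x₂) y + 1 :=
  (listLcs_append_cons_le x₁ x₂ y b).trans
    (Nat.add_le_add_right
      (listLcs_mono ((List.sublist_cons_self b' x₂).append_left x₁) (List.Sublist.refl y)) 1)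

/-- The Monge inequality for two crossing alignment paths. -/
theorem listLcs_monge_aux (a : α) (N : ℕ) : ∀ u x t y : List α,
    2 * x.length + 2 * y.length + t.length + u.length ≤ N →
      listLcs x (t ++ y) + listLcs (u ++ x ++ [a]) y ≤
        listLcs (x ++ [a]) (t ++ y) + listLcs (u ++ x) y := by
  induction N with
  | zero =>
    intro u x t y h
    obtain rfl : y = [] := List.length_eq_zero_iff.1 (by omega)
    obtain rfl : x = [] := List.length_eq_zero_iff.1 (by omega)
    simp [listLcs_nil_right, listLcs_nil_left]
  | succ N ih =>
    intro u x t y h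
    match t with
    | b :: t =>
      match x with
      | [] =>
        have h1 := listLcs_append_cons_le u [] y a
        rw [List.append_nil] at h1
        rcases h1.lt_or_eq with h1 | h1
        · simp only [listLcs_nil_left, List.append_nil, List.nil_append]
          omega
        · have hy : listLcs [a] (b :: t ++ y) ≥ 1 := by
            obtain ⟨w, h3, h4, h5⟩ := exists_length_eq_listLcs (u ++ [a]) y
            have ha : a ∈ w := by
              by_contra hw
              have : w.Sublist u := by
                obtain ⟨w₁, w₂, rfl, h6, h7⟩ := List.sublist_append_iff.1 h3
                rcases List.sublist_singleton.1 h7 with rfl | rfl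
                · simpa using h6
                · simp at hw
              have := length_le_listLcs this h4
              omega
            exact length_le_listLcs (List.Sublist.refl [a])
              (List.singleton_sublist.2 (List.mem_append_right _ (h4.subset ha)))
          simp only [listLcs_nil_left, List.append_nil, List.nil_append] at hy ⊢
          omega
      | c :: x =>
        simp only [List.length_cons] at h
        rcases listLcs_cons_cons_cases c b x (t ++ y) with h1 | h1 | ⟨rfl, h1⟩
        · have := ih (u ++ [c]) x (b :: t) y (by simp; omega)
          have h2 : listLcs (x ++ [a]) (b :: t ++ y) ≤ listLcs (c :: x ++ [a]) (b :: t ++ y) :=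
            listLcs_mono (List.sublist_cons_self _ _) (List.Sublist.refl _)
          simp only [List.append_assoc, List.cons_append, List.nil_append] at this h1 h2 ⊢
          omega
        · have := ih u (c :: x) t y (by simp; omega)
          have h2 : listLcs (c :: x ++ [a]) (t ++ y) ≤ listLcs (c :: x ++ [a]) (b :: t ++ y) :=
            listLcs_mono (List.Sublist.refl _) (List.sublist_cons_self _ _)
          simp only [List.append_assoc, List.cons_append] at this h1 h2 ⊢
          omega
        · have := ih (u ++ [c]) x t y (by simp; omega)
          have h2 := listLcs_add_one_le c (x ++ [a]) (t ++ y)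
          simp only [List.append_assoc, List.cons_append, List.nil_append] at this h1 h2 ⊢
          omega
    | [] =>
      match u with
      | [] => simp [add_comm]
      | c :: u =>
        match y with
        | [] => simp [listLcs_nil_right]
        | d :: y =>
          simp only [List.length_cons, List.length_nil] at h
          rcases listLcs_cons_cons_cases c d (u ++ x ++ [a]) y with h1 | h1 | ⟨rfl, h1⟩
          · have := ih u x [] (d :: y) (by simp; omega)
            have h2 : listLcs (u ++ x) (d :: y) ≤ listLcs (c :: u ++ x) (d :: y) :=
              listLcs_mono (List.sublist_cons_self _ _) (List.Sublist.refl _)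
            simp only [List.append_assoc, List.cons_append, List.nil_append] at this h1 h2 ⊢
            omega
          · have := ih (c :: u) x [d] y (by simp; omega)
            have h2 : listLcs (c :: u ++ x) y ≤ listLcs (c :: u ++ x) (d :: y) :=
              listLcs_mono (List.Sublist.refl _) (List.sublist_cons_self _ _)
            simp only [List.append_assoc, List.cons_append, List.nil_append] at this h1 h2 ⊢
            omega
          · have := ih u x [c] y (by simp; omega)
            have h2 := listLcs_add_one_le c (u ++ x) y
            simp only [List.append_assoc, List.cons_append, List.nil_append] at this h1 h2 ⊢
            omega

theorem listLcs_monge (a b : α) (x y : List α) :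
    listLcs x (b :: y) + listLcs (x ++ [a]) y ≤ listLcs (x ++ [a]) (b :: y) + listLcs x y := by
  simpa using listLcs_monge_aux a _ [] x [b] y le_rfl

theorem lcsLength_eq_listLcs {n : ℕ} (x y : Fin n → α) :
    lcsLength x y = listLcs (List.ofFn x) (List.ofFn y) := by
  unfold lcsLength listLcs
  congr 1
  ext k
  constructor
  · rintro ⟨i, j, hi, hj, h⟩
    refine ⟨List.ofFn (fun a => x (i a)), ?_, ?_, by simp⟩
    · rw [List.sublist_iff_exists_fin_orderEmbedding_get_eq]
      refine ⟨OrderEmbedding.ofStrictMono (fun a => (i (a.cast (by simp))).cast (by simp)) ?_, ?_⟩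
      · intro a b hab
        exact hi hab
      · intro a
        simp
        rfl
    · simp only [h]
      rw [List.sublist_iff_exists_fin_orderEmbedding_get_eq]
      refine ⟨OrderEmbedding.ofStrictMono (fun a => (j (a.cast (by simp))).cast (by simp)) ?_, ?_⟩
      · intro a b hab
        exact hj hab
      · intro a
        simp
        rfl
  · rintro ⟨w, hx, hy, rfl⟩
    rw [List.sublist_iff_exists_fin_orderEmbedding_get_eq] at hx hy
    obtain ⟨f, hf⟩ := hx
    obtain ⟨g, hg⟩ := hy
    refine ⟨fun a => (f a).cast (by simp), fun a => (g a).cast (by simp), ?_, ?_, ?_⟩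
    · intro a b hab
      exact f.strictMono hab
    · intro a b hab
      exact g.strictMono hab
    · intro a
      have h1 := hf a
      have h2 := hg a
      rw [h1] at h2
      simp only [List.get_ofFn] at h2
      exact h2

end Lists

/-- The sum of `f` over the lists obtained from `x` by removing one letter `true`. -/
def eraseTrueSum (f : List Bool → ℝ) : List Bool → ℝ
  | [] => 0
  | b :: x => (if b then f x else 0) + eraseTrueSum (fun x' => f (b :: x')) x

theorem le_eraseTrueSum {w x : List Bool} (h : w.Sublist x) (c : ℝ) :
    ∀ f : List Bool → ℝ, (∀ v x' : List Bool, v.Sublist w → v.Sublist x' →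
      c - ((w.length : ℝ) - v.length) ≤ f x') →
      x.count true * c - w.count true ≤ eraseTrueSum f x := by
  induction h with
  | slnil => intro f _; simp [eraseTrueSum]
  | @cons w x b h ih =>
    intro f hf
    have h1 := ih (fun x' => f (b :: x')) fun v x' hv hx' =>
      hf v (b :: x') hv (hx'.trans (List.sublist_cons_self _ _))
    have h2 := hf w x (List.Sublist.refl w) h
    cases b <;> simp [eraseTrueSum] at h1 h2 ⊢ <;> linarith
  | @cons_cons w x b h ih =>
    intro f hf
    have h1 := ih (fun x' => f (b :: x')) fun v x' hv hx' => by
      have := hf (b :: v) (b :: x') (hv.cons_cons b) (hx'.cons_cons b)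
      simpa using this
    have h2 := hf w x (List.sublist_cons_self _ _) h
    cases b <;> simp [eraseTrueSum] at h1 h2 ⊢ <;> linarith

theorem min_count_false_le_listLcs (x y : List Bool) :
    min (x.count false) (y.count false) ≤ listLcs x y := by
  have := length_le_listLcs (w := List.replicate (min (x.count false) (y.count false)) false)
    (x := x) (y := y) (List.replicate_sublist_iff.2 (min_le_left _ _))
    (List.replicate_sublist_iff.2 (min_le_right _ _))
  simpa using this

/-- The expectation of `f` over a random list of `n` independent Bernoulli letters with
parameter `ε`. -/
def bernExp (ε : ℝ) : ℕ → (List Bool → ℝ) → ℝ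
  | 0, f => f []
  | n + 1, f => ε * bernExp ε n (fun x => f (true :: x)) +
      (1 - ε) * bernExp ε n (fun x => f (false :: x))

namespace bernExp

variable {ε : ℝ} {n : ℕ}

theorem zero (f : List Bool → ℝ) : bernExp ε 0 f = f [] := rfl

theorem succ (n : ℕ) (f : List Bool → ℝ) : bernExp ε (n + 1) f =
    ε * bernExp ε n (fun x => f (true :: x)) + (1 - ε) * bernExp ε n (fun x => f (false :: x)) :=
  rfl

theorem add (f g : List Bool → ℝ) :
    bernExp ε n (fun x => f x + g x) = bernExp ε n f + bernExp ε n g := by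
  induction n generalizing f g with
  | zero => rfl
  | succ n ih => simp only [succ, ih]; ring

theorem mul_left (c : ℝ) (f : List Bool → ℝ) :
    bernExp ε n (fun x => c * f x) = c * bernExp ε n f := by
  induction n generalizing f with
  | zero => rfl
  | succ n ih => simp only [succ, ih]; ring

theorem sub (f g : List Bool → ℝ) :
    bernExp ε n (fun x => f x - g x) = bernExp ε n f - bernExp ε n g := by
  have := add (ε := ε) (n := n) f (fun x => (-1) * g x)
  rw [mul_left] at this
  simp only [neg_one_mul, ← sub_eq_add_neg] at this
  exact this

theorem const (c : ℝ) : bernExp ε n (fun _ => c) = c := by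
  induction n with
  | zero => rfl
  | succ n ih => simp only [succ, ih]; ring

theorem mono_of_length (h0 : 0 ≤ ε) (h1 : ε ≤ 1) {f g : List Bool → ℝ}
    (h : ∀ x, x.length = n → f x ≤ g x) : bernExp ε n f ≤ bernExp ε n g := by
  induction n generalizing f g with
  | zero => exact h [] rfl
  | succ n ih =>
    have h1' : 0 ≤ 1 - ε := by linarith
    exact add_le_add
      (mul_le_mul_of_nonneg_left (ih fun x hx => h _ (by simp [hx])) h0)
      (mul_le_mul_of_nonneg_left (ih fun x hx => h _ (by simp [hx])) h1')

theorem mono (h0 : 0 ≤ ε) (h1 : ε ≤ 1) {f g : List Bool → ℝ} (h : ∀ x, f x ≤ g x) :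
    bernExp ε n f ≤ bernExp ε n g :=
  mono_of_length h0 h1 fun x _ => h x

theorem nonneg (h0 : 0 ≤ ε) (h1 : ε ≤ 1) {f : List Bool → ℝ} (h : ∀ x, 0 ≤ f x) :
    0 ≤ bernExp ε n f :=
  (const (ε := ε) (n := n) 0).symm.le.trans (mono h0 h1 h)

theorem comm (m n : ℕ) (f : List Bool → List Bool → ℝ) :
    bernExp ε m (fun x => bernExp ε n fun y => f x y) =
      bernExp ε n (fun y => bernExp ε m fun x => f x y) := by
  induction m generalizing f with
  | zero => rfl
  | succ m ih => simp only [succ, ih, add, mul_left]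

theorem succ_append (n : ℕ) (f : List Bool → ℝ) : bernExp ε (n + 1) f =
    ε * bernExp ε n (fun x => f (x ++ [true])) +
      (1 - ε) * bernExp ε n (fun x => f (x ++ [false])) := by
  induction n generalizing f with
  | zero => rfl
  | succ n ih =>
    rw [succ, ih, ih, succ n fun x => f (x ++ [true]), succ n fun x => f (x ++ [false])]
    simp only [List.cons_append]
    ring

theorem count_true : bernExp ε n (fun x => (x.count true : ℝ)) = n * ε := by
  induction n with
  | zero => simp [zero]
  | succ n ih =>
    simp only [succ, List.count_cons_self, List.count_cons, Nat.cast_add, Nat.cast_one, add,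
      const, ih, beq_iff_eq, Bool.false_eq_true, if_false, Nat.cast_zero]
    ring

theorem count_true_sq :
    bernExp ε n (fun x => (x.count true : ℝ) ^ 2) = n * ε * (1 - ε) + (n * ε) ^ 2 := by
  induction n with
  | zero => simp [zero]
  | succ n ih =>
    have h : ∀ x : List Bool, ((x.count true : ℝ) + 1) ^ 2 =
        (x.count true : ℝ) ^ 2 + (2 * (x.count true : ℝ) + 1) := fun x => by ring
    simp only [succ, List.count_cons_self, List.count_cons, Nat.cast_add, Nat.cast_one,
      beq_iff_eq, Bool.false_eq_true, if_false, h, add, mul_left, const, ih, count_true, add_zero]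
    ring

theorem eraseTrueSum (f : List Bool → ℝ) :
    bernExp ε (n + 1) (eraseTrueSum f) = (n + 1) * (ε * bernExp ε n f) := by
  induction n generalizing f with
  | zero => simp [succ, zero, _root_.eraseTrueSum]
  | succ n ih =>
    rw [succ]
    simp only [_root_.eraseTrueSum, if_true, Bool.false_eq_true, if_false, zero_add, add, ih]
    rw [succ n f]
    push_cast
    ring

/-- Cauchy-Schwarz for a pair of random lists. -/
theorem mul_sq_le (h0 : 0 ≤ ε) (h1 : ε ≤ 1) (m n : ℕ) (f g : List Bool → List Bool → ℝ) :
    bernExp ε m (fun x => bernExp ε n fun y => f x y * g x y) ^ 2 ≤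
      bernExp ε m (fun x => bernExp ε n fun y => f x y ^ 2) *
        bernExp ε m (fun x => bernExp ε n fun y => g x y ^ 2) := by
  have key : ∀ t : ℝ, 0 ≤ bernExp ε m (fun x => bernExp ε n fun y => f x y ^ 2) * (t * t) +
      (2 * bernExp ε m (fun x => bernExp ε n fun y => f x y * g x y)) * t +
        bernExp ε m (fun x => bernExp ε n fun y => g x y ^ 2) := by
    intro t
    have h : 0 ≤ bernExp ε m (fun x => bernExp ε n fun y => (t * f x y + g x y) ^ 2) :=
      nonneg h0 h1 fun x => nonneg h0 h1 fun y => sq_nonneg _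
    have e : ∀ x y, (t * f x y + g x y) ^ 2 =
        t * t * f x y ^ 2 + (2 * t * (f x y * g x y) + g x y ^ 2) := fun x y => by ring
    simp only [e, add, mul_left] at h
    linarith
  have := discrim_le_zero key
  rw [discrim] at this
  linarith

/-- The Efron-Stein inequality for functions with differences at most one. -/
theorem variance_le (h0 : 0 ≤ ε) (h1 : ε ≤ 1) (f : List Bool → ℝ)
    (hf : ∀ x₁ x₂ b b', f (x₁ ++ b :: x₂) ≤ f (x₁ ++ b' :: x₂) + 1) :
    bernExp ε n (fun x => f x ^ 2) ≤ bernExp ε n f ^ 2 + n * (ε * (1 - ε)) := by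
  induction n generalizing f with
  | zero => simp [zero]
  | succ n ih =>
    have h2 := ih (fun x => f (true :: x)) fun x₁ x₂ b b' => hf (true :: x₁) x₂ b b'
    have h3 := ih (fun x => f (false :: x)) fun x₁ x₂ b b' => hf (false :: x₁) x₂ b b'
    have h4 : bernExp ε n (fun x => f (true :: x)) ≤ bernExp ε n (fun x => f (false :: x) + 1) :=
      mono h0 h1 fun x => hf [] x true false
    have h5 : bernExp ε n (fun x => f (false :: x)) ≤ bernExp ε n (fun x => f (true :: x) + 1) :=
      mono h0 h1 fun x => hf [] x false true
    rw [add, const] at h4 h5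
    rw [succ, succ]
    set p := bernExp ε n (fun x => f (true :: x))
    set q := bernExp ε n (fun x => f (false :: x))
    have h6 : (p - q) ^ 2 ≤ 1 := by
      rw [sq_le_one_iff_abs_le_one, abs_le]; constructor <;> linarith
    have h7 : 0 ≤ 1 - ε := by linarith
    have h8 := mul_le_mul_of_nonneg_left h6 (mul_nonneg h0 h7)
    have h9 := mul_le_mul_of_nonneg_left h2 h0
    have h10 := mul_le_mul_of_nonneg_left h3 h7
    push_cast
    nlinarith

end bernExp

/-- The weight of deleting a letter next to a matched pair of letters `true`. -/
noncomputable def deletionWeight (b : Bool) : ℝ := if b then 1 else 1 / 8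

/-- Partition functions of alignments of two lists. The first component only allows to delete
letters `true`, to match letters `false` and, with weight `W`, to match letters `true`; after such
a match the second component, which also allows to delete letters `false`, takes over. -/
noncomputable def alignZ (W : ℝ) : List Bool → List Bool → ℝ × ℝ
  | [], [] => (1, 1)
  | a :: x, [] =>
    let A := if a then (alignZ W x []).1 else 0
    (A, A + deletionWeight a * (alignZ W x []).2)
  | [], b :: y =>
    let A := if b then (alignZ W [] y).1 else 0
    (A, A + deletionWeight b * (alignZ W [] y).2)
  | a :: x, b :: y =>
    let A := (if a then (alignZ W x (b :: y)).1 else 0) + (if b then (alignZ W (a :: x) y).1 else 0)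
      + (if a then 0 else if b then 0 else (alignZ W x y).1)
      + (if a then if b then W * (alignZ W x y).2 else 0 else 0)
    (A, A + deletionWeight a * (alignZ W x (b :: y)).2 + deletionWeight b * (alignZ W (a :: x) y).2)
termination_by x y => x.length + y.length

section

variable {W : ℝ}

theorem deletionWeight_nonneg (b : Bool) : 0 ≤ deletionWeight b := by
  unfold deletionWeight; split_ifs <;> norm_num

theorem alignZ_nonneg (hW : 0 ≤ W) (x y : List Bool) :
    0 ≤ (alignZ W x y).1 ∧ 0 ≤ (alignZ W x y).2 := by
  induction x, y using alignZ.induct (W := W) with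
  | case1 => rw [alignZ]; simp
  | case2 a x ih =>
    have := deletionWeight_nonneg a
    obtain ⟨h1, h2⟩ := ih
    rw [alignZ]
    constructor <;> dsimp only <;> split_ifs <;> positivity
  | case3 a x ih =>
    have := deletionWeight_nonneg a
    obtain ⟨h1, h2⟩ := ih
    rw [alignZ]
    constructor <;> dsimp only <;> split_ifs <;> positivity
  | case4 a x b y ih1 ih2 ih3 =>
    have := deletionWeight_nonneg a
    have := deletionWeight_nonneg b
    obtain ⟨h1, h2⟩ := ih1
    obtain ⟨h3, h4⟩ := ih2
    obtain ⟨h5, h6⟩ := ih3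
    rw [alignZ]
    constructor <;> dsimp only <;> split_ifs <;> positivity

theorem alignZ_fst_le_snd (hW : 0 ≤ W) (x y : List Bool) :
    (alignZ W x y).1 ≤ (alignZ W x y).2 := by
  match x, y with
  | [], [] => rw [alignZ]
  | a :: x, [] =>
    rw [alignZ]
    exact le_add_of_nonneg_right (mul_nonneg (deletionWeight_nonneg a) (alignZ_nonneg hW x []).2)
  | [], b :: y =>
    rw [alignZ]
    exact le_add_of_nonneg_right (mul_nonneg (deletionWeight_nonneg b) (alignZ_nonneg hW [] y).2)
  | a :: x, b :: y =>
    rw [alignZ]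
    dsimp only
    rw [add_assoc _ (deletionWeight a * _)]
    exact le_add_of_nonneg_right (add_nonneg
      (mul_nonneg (deletionWeight_nonneg a) (alignZ_nonneg hW x (b :: y)).2)
      (mul_nonneg (deletionWeight_nonneg b) (alignZ_nonneg hW (a :: x) y).2))

theorem alignZ_comm (x y : List Bool) : alignZ W x y = alignZ W y x := by
  induction x, y using alignZ.induct (W := W) with
  | case1 => rfl
  | case2 a x ih => rw [alignZ, alignZ, ih]
  | case3 a x ih => rw [alignZ, alignZ, ih]
  | case4 a x b y ih1 ih2 ih3 =>
    rw [alignZ, alignZ, ih1, ih2, ih3]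
    cases a <;> cases b <;> ext <;> simp <;> ring

theorem alignZ_snd_cons_left (hW : 0 ≤ W) (a : Bool) (x y : List Bool) :
    deletionWeight a * (alignZ W x y).2 ≤ (alignZ W (a :: x) y).2 := by
  match y with
  | [] =>
    have h := (alignZ_nonneg hW x []).1
    rw [alignZ]
    dsimp only
    split_ifs <;> linarith
  | b :: y =>
    have h0 := (alignZ_nonneg hW (a :: x) (b :: y)).1
    have h1 := mul_nonneg (deletionWeight_nonneg b) (alignZ_nonneg hW (a :: x) y).2
    rw [alignZ] at h0 ⊢
    dsimp only at h0 ⊢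
    linarith

theorem alignZ_fst_cons_true_left (hW : 0 ≤ W) (x y : List Bool) :
    (alignZ W x y).1 ≤ (alignZ W (true :: x) y).1 := by
  match y with
  | [] => rw [alignZ]; simp
  | b :: y =>
    have h1 := (alignZ_nonneg hW (true :: x) y).1
    have h2 := (alignZ_nonneg hW x y).2
    have h3 := mul_nonneg hW h2
    rw [alignZ.eq_def W (true :: x)]
    cases b <;> simp
    linarith

theorem alignZ_fst_cons_false (x y : List Bool) :
    (alignZ W x y).1 ≤ (alignZ W (false :: x) (false :: y)).1 := by
  rw [alignZ.eq_def W (false :: x)]; simp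

theorem alignZ_fst_cons_true (hW : 0 ≤ W) (x y : List Bool) :
    W * (alignZ W x y).2 ≤ (alignZ W (true :: x) (true :: y)).1 := by
  have h1 := (alignZ_nonneg hW (true :: x) y).1
  have h2 := (alignZ_nonneg hW x (true :: y)).1
  rw [alignZ.eq_def W (true :: x)]
  simp
  linarith

theorem alignZ_fst_append_le (hW : 0 ≤ W) (x y : List Bool) :
    ∀ s t : List Bool, s.count false = t.count false →
      (alignZ W x y).1 ≤ (alignZ W (s ++ x) (t ++ y)).1 := by
  intro s t
  induction s, t using alignZ.induct (W := W) with
  | case1 => intro _; exact le_rfl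
  | case2 a s ih =>
    intro h
    cases a with
    | false => simp at h
    | true => exact (ih (by simpa using h)).trans (alignZ_fst_cons_true_left hW _ _)
  | case3 b t ih =>
    intro h
    cases b with
    | false => simp at h
    | true =>
      refine (ih (by simpa using h)).trans ?_
      rw [alignZ_comm, alignZ_comm (y := true :: t ++ y)]
      exact alignZ_fst_cons_true_left hW _ _
  | case4 a s b t ih1 ih2 ih3 =>
    intro h
    cases a with
    | true => exact (ih1 (by simpa using h)).trans (alignZ_fst_cons_true_left hW _ _)
    | false =>
      cases b with
      | true =>
        refine (ih2 (by simpa using h)).trans ?_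
        rw [alignZ_comm, alignZ_comm (y := true :: t ++ y)]
        exact alignZ_fst_cons_true_left hW _ _
      | false => exact (ih3 (by simpa using h)).trans (alignZ_fst_cons_false _ _)

theorem alignZ_snd_append_of_le (hW : 0 ≤ W) (x y t : List Bool) :
    ∀ s : List Bool, t.count false ≤ s.count false →
      (1 / 8 : ℝ) ^ (s.count false - t.count false) * (alignZ W x y).1 ≤
        (alignZ W (s ++ x) (t ++ y)).2 := by
  intro s
  induction s with
  | nil =>
    intro h
    simp only [List.count_nil, Nat.le_zero] at h
    have := alignZ_fst_append_le hW x y [] t (by simp [h])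
    simp only [List.count_nil, h, Nat.sub_self, pow_zero, one_mul]
    exact this.trans (alignZ_fst_le_snd hW _ _)
  | cons a s ih =>
    intro h
    rcases h.eq_or_lt with h | h
    · rw [h, Nat.sub_self, pow_zero, one_mul]
      exact (alignZ_fst_append_le hW x y _ t h.symm).trans (alignZ_fst_le_snd hW _ _)
    · have h2 := alignZ_snd_cons_left hW a (s ++ x) (t ++ y)
      refine le_trans ?_ h2
      cases a with
      | true =>
        simpa [deletionWeight] using ih (by simp at h; omega)
      | false =>
        simp only [List.count_cons_self] at h ⊢
        rw [Nat.succ_sub (by omega), pow_succ', mul_assoc]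
        exact mul_le_mul_of_nonneg_left (ih (by omega)) (by norm_num)

theorem alignZ_snd_append_le (hW : 0 ≤ W) (x y s t : List Bool) {d : ℕ}
    (hs : s.count false ≤ t.count false + d) (ht : t.count false ≤ s.count false + d) :
    (1 / 8 : ℝ) ^ d * (alignZ W x y).1 ≤ (alignZ W (s ++ x) (t ++ y)).2 := by
  have h0 := (alignZ_nonneg hW x y).1
  rcases le_total (t.count false) (s.count false) with h | h
  · refine le_trans (mul_le_mul_of_nonneg_right ?_ h0) (alignZ_snd_append_of_le hW x y t s h)
    exact pow_le_pow_of_le_one (by norm_num) (by norm_num) (by omega)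
  · rw [alignZ_comm, alignZ_comm (y := t ++ y)]
    refine le_trans (mul_le_mul_of_nonneg_right ?_ (alignZ_comm x y ▸ h0))
      (alignZ_snd_append_of_le hW y x s t h)
    exact pow_le_pow_of_le_one (by norm_num) (by norm_num) (by omega)

/-- A list with a letter `true` splits at the first one. -/
theorem exists_split_at_true (w : List Bool) :
    w.count true = 0 ∨ ∃ m w', w = List.replicate m false ++ true :: w' := by
  induction w with
  | nil => simp
  | cons b w ih =>
    cases b with
    | true => exact Or.inr ⟨0, w, rfl⟩
    | false =>
      rcases ih with h | ⟨m, w', rfl⟩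
      · exact Or.inl (by simpa using h)
      · exact Or.inr ⟨m + 1, w', by simp [List.replicate_succ]⟩

theorem exists_split_of_sublist {m : ℕ} {w x : List Bool}
    (h : (List.replicate m false ++ true :: w).Sublist x) :
    ∃ s x', x = s ++ true :: x' ∧ m ≤ s.count false ∧ w.Sublist x' := by
  obtain ⟨s, r, rfl, h1, h2⟩ := List.append_sublist_iff.1 h
  obtain ⟨r₁, r₂, rfl, h3, h4⟩ := List.cons_sublist_iff.1 h2
  obtain ⟨p, q, rfl⟩ := List.append_of_mem h3
  refine ⟨s ++ p, q ++ r₂, by simp, ?_, h4.trans (List.sublist_append_right q r₂)⟩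
  have := List.replicate_sublist_iff.1 h1
  rw [List.count_append]
  omega

theorem weight_le_alignZ (hW : 0 ≤ W) (N : ℕ) : ∀ (w x y : List Bool) (d : ℕ),
    w.length ≤ N → w.Sublist x → w.Sublist y →
    x.count false + y.count false ≤ 2 * w.count false + d →
      (1 / 8 : ℝ) ^ d * W ^ (w.count true) ≤ (alignZ W x y).2 := by
  induction N with
  | zero =>
    intro w x y d hw hx hy hd
    obtain rfl := List.length_eq_zero_iff.1 (Nat.le_zero.1 hw)
    have := alignZ_snd_append_le hW [] [] x y (d := d) (by simp at hd; omega) (by simp at hd; omega)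
    rw [alignZ] at this
    simpa using this
  | succ N ih =>
    intro w x y d hw hx hy hd
    have hx' := hx.count_le false
    have hy' := hy.count_le false
    rcases exists_split_at_true w with h | ⟨m, w', rfl⟩
    · have := alignZ_snd_append_le hW [] [] x y (d := d) (by omega) (by omega)
      rw [alignZ] at this
      simpa [h] using this
    · obtain ⟨s, x', rfl, h1, h2⟩ := exists_split_of_sublist hx
      obtain ⟨t, y', rfl, h3, h4⟩ := exists_split_of_sublist hy
      have h5 := h2.count_le false
      have h6 := h4.count_le false
      simp only [List.count_append, List.count_replicate_self, List.count_cons, beq_iff_eq,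
        Bool.true_eq_false, if_false, add_zero] at hd
      have hlen : w'.length ≤ N := by simp at hw; omega
      have := ih w' x' y' (x'.count false + y'.count false - 2 * w'.count false) hlen h2 h4
        (by omega)
      have h7 := alignZ_fst_cons_true hW x' y'
      have h8 := alignZ_snd_append_le hW (true :: x') (true :: y') s t
        (d := s.count false + t.count false - 2 * m) (by omega) (by omega)
      have hc : (List.replicate m false ++ true :: w').count true = w'.count true + 1 := by
        simp [List.count_replicate]
      have hd' : s.count false + t.count false - 2 * m +
          (x'.count false + y'.count false - 2 * w'.count false) ≤ d := by omega
      calc (1 / 8 : ℝ) ^ d * W ^ ((List.replicate m false ++ true :: w').count true)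
          ≤ (1 / 8 : ℝ) ^ (s.count false + t.count false - 2 * m +
            (x'.count false + y'.count false - 2 * w'.count false)) * W ^ (w'.count true + 1) := by
              rw [hc]
              exact mul_le_mul_of_nonneg_right
                (pow_le_pow_of_le_one (by norm_num) (by norm_num) hd') (pow_nonneg hW _)
        _ = (1 / 8 : ℝ) ^ (s.count false + t.count false - 2 * m) * (W * ((1 / 8 : ℝ) ^
            (x'.count false + y'.count false - 2 * w'.count false) * W ^ (w'.count true))) := by
              rw [pow_add, pow_succ]; ring
        _ ≤ (1 / 8 : ℝ) ^ (s.count false + t.count false - 2 * m) * (W * (alignZ W x' y').2) := by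
              gcongr
        _ ≤ (1 / 8 : ℝ) ^ (s.count false + t.count false - 2 * m) *
            (alignZ W (true :: x') (true :: y')).1 := by gcongr
        _ ≤ _ := h8

end

/-- The expected partition function `alignZ.1`. -/
noncomputable def meanZfst (ε W : ℝ) (m n : ℕ) : ℝ :=
  bernExp ε m fun x => bernExp ε n fun y => (alignZ W x y).1

/-- The expected partition function `alignZ.2`. -/
noncomputable def meanZsnd (ε W : ℝ) (m n : ℕ) : ℝ :=
  bernExp ε m fun x => bernExp ε n fun y => (alignZ W x y).2

theorem meanZ_comm (ε W : ℝ) (m n : ℕ) :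
    meanZfst ε W m n = meanZfst ε W n m ∧ meanZsnd ε W m n = meanZsnd ε W n m := by
  unfold meanZfst meanZsnd
  constructor <;>
  · rw [bernExp.comm]
    simp only [fun x y => alignZ_comm (W := W) x y]

theorem meanZ_zero_succ (ε W : ℝ) (n : ℕ) :
    meanZfst ε W 0 (n + 1) = ε * meanZfst ε W 0 n ∧
      meanZsnd ε W 0 (n + 1) =
        meanZfst ε W 0 (n + 1) + (ε + (1 - ε) * (1 / 8)) * meanZsnd ε W 0 n := by
  unfold meanZfst meanZsnd
  simp only [bernExp.zero, bernExp.succ, alignZ, if_true, Bool.false_eq_true, if_false,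
    bernExp.add, bernExp.mul_left, bernExp.const, deletionWeight]
  constructor <;> ring

theorem meanZ_succ_succ (ε W : ℝ) (m n : ℕ) :
    meanZfst ε W (m + 1) (n + 1) = ε * meanZfst ε W m (n + 1) + ε * meanZfst ε W (m + 1) n +
        (1 - ε) ^ 2 * meanZfst ε W m n + ε ^ 2 * W * meanZsnd ε W m n ∧
      meanZsnd ε W (m + 1) (n + 1) = meanZfst ε W (m + 1) (n + 1) +
        (ε + (1 - ε) * (1 / 8)) * (meanZsnd ε W m (n + 1) + meanZsnd ε W (m + 1) n) := by
  unfold meanZfst meanZsnd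
  simp only [bernExp.succ, alignZ, if_true, Bool.false_eq_true, if_false, bernExp.add,
    bernExp.mul_left, bernExp.const, deletionWeight]
  constructor <;> ring

theorem meanZ_zero_le {ε : ℝ} (W : ℝ) (h0 : 0 < ε) (h1 : ε ≤ 1 / 8) (n : ℕ) :
    meanZfst ε W 0 n ≤ (1 + 2 * ε) ^ n ∧ meanZsnd ε W 0 n ≤ 2 * (1 + 2 * ε) ^ n := by
  induction n with
  | zero => simp [meanZfst, meanZsnd, bernExp.zero, alignZ]
  | succ n ih =>
    obtain ⟨h2, h3⟩ := meanZ_zero_succ ε W n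
    obtain ⟨ih1, ih2⟩ := ih
    have hR : 0 < (1 + 2 * ε) ^ n := by positivity
    have h4 : meanZfst ε W 0 (n + 1) ≤ (1 + 2 * ε) ^ (n + 1) := by
      rw [h2, pow_succ']
      nlinarith
    refine ⟨h4, ?_⟩
    rw [h3]
    have : (ε + (1 - ε) * (1 / 8)) * meanZsnd ε W 0 n ≤
        1 / 4 * (2 * (1 + 2 * ε) ^ n) :=
      (mul_le_mul_of_nonneg_left ih2 (by linarith)).trans
        (mul_le_mul_of_nonneg_right (by linarith) (by positivity))
    have h5 : (1 + 2 * ε) ^ n ≤ (1 + 2 * ε) ^ (n + 1) :=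
      pow_le_pow_right₀ (by linarith) (Nat.le_succ n)
    linarith

/-- The expected partition functions grow at most at rate `1 + 2 * ε` per letter. -/
theorem meanZ_le {ε : ℝ} (h0 : 0 < ε) (h1 : ε ≤ 1 / 8) (m n : ℕ) :
    meanZfst ε (1 / ε) m n ≤ (1 + 2 * ε) ^ (m + n) ∧
      meanZsnd ε (1 / ε) m n ≤ 2 * (1 + 2 * ε) ^ (m + n) := by
  induction m generalizing n with
  | zero => simpa using meanZ_zero_le (1 / ε) h0 h1 n
  | succ m ihm =>
    induction n with
    | zero =>
      rw [(meanZ_comm _ _ _ _).1, (meanZ_comm _ _ _ _).2]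
      exact meanZ_zero_le (1 / ε) h0 h1 (m + 1)
    | succ n ih =>
      obtain ⟨h2, h3⟩ := meanZ_succ_succ ε (1 / ε) m n
      obtain ⟨a1, b1⟩ := ih
      obtain ⟨a2, b2⟩ := ihm (n + 1)
      obtain ⟨a3, b3⟩ := ihm n
      rw [show m + 1 + n = m + n + 1 by ring, pow_succ] at a1 b1
      rw [show m + (n + 1) = m + n + 1 by ring, pow_succ] at a2 b2
      rw [show ε ^ 2 * (1 / ε) = ε by field_simp] at h2
      rw [show m + 1 + (n + 1) = m + n + 1 + 1 by ring, pow_succ, pow_succ]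
      have hR : 0 < (1 + 2 * ε) ^ (m + n) := by positivity
      generalize (1 + 2 * ε) ^ (m + n) = R at *
      have h4 : meanZfst ε (1 / ε) (m + 1) (n + 1) ≤ R * (1 + 2 * ε) * (1 + 2 * ε) := by
        have e1 := mul_le_mul_of_nonneg_left a1 h0.le
        have e2 := mul_le_mul_of_nonneg_left a2 h0.le
        have e3 := mul_le_mul_of_nonneg_left a3 (sq_nonneg (1 - ε))
        have e4 := mul_le_mul_of_nonneg_left b3 h0.le
        have e5 : 0 ≤ R * (ε * (2 - ε)) := by
          have : 0 ≤ 2 - ε := by linarith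
          positivity
        nlinarith
      refine ⟨h4, ?_⟩
      rw [h3]
      have h5 : (ε + (1 - ε) * (1 / 8)) *
          (meanZsnd ε (1 / ε) m (n + 1) + meanZsnd ε (1 / ε) (m + 1) n) ≤
          1 / 4 * (4 * (R * (1 + 2 * ε))) :=
        (mul_le_mul_of_nonneg_left (by linarith) (by linarith)).trans
          (mul_le_mul_of_nonneg_right (by linarith) (by positivity))
      have h6 : 0 ≤ R * (1 + 2 * ε) * (2 * ε) := by positivity
      linarith

/-- The number of letters `true` in a chosen longest common sublist. -/
noncomputable def matchedTrue (x y : List Bool) : ℕ :=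
  (exists_length_eq_listLcs x y).choose.count true

theorem matchedTrue_le_left (x y : List Bool) : matchedTrue x y ≤ x.count true :=
  (exists_length_eq_listLcs x y).choose_spec.1.count_le true

theorem matchedTrue_le_right (x y : List Bool) : matchedTrue x y ≤ y.count true :=
  (exists_length_eq_listLcs x y).choose_spec.2.1.count_le true

theorem matchedTrue_le_mul (x y : List Bool) :
    matchedTrue x y ≤ x.count true * y.count true :=
  (Nat.le_mul_self _).trans
    (Nat.mul_le_mul (matchedTrue_le_left x y) (matchedTrue_le_right x y))

theorem count_mul_listLcs_sub_le (x y : List Bool) :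
    (x.count true : ℝ) * listLcs x y - matchedTrue x y ≤
      eraseTrueSum (fun x' => (listLcs x' y : ℝ)) x := by
  obtain ⟨h1, h2, h3⟩ := (exists_length_eq_listLcs x y).choose_spec
  refine le_eraseTrueSum h1 _ _ fun v x' hv hx' => ?_
  have h4 : (v.length : ℝ) ≤ listLcs x' y := by exact_mod_cast length_le_listLcs hx' (hv.trans h2)
  rw [h3]
  linarith

theorem weight_matchedTrue_le_alignZ {W : ℝ} (hW : 0 ≤ W) (x y : List Bool)
    (h : x.length = y.length) :
    (1 / 8 : ℝ) ^ (((x.count true : ℤ) - y.count true).natAbs + 2 * matchedTrue x y) *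
      W ^ matchedTrue x y ≤ (alignZ W x y).2 := by
  obtain ⟨h1, h2, h3⟩ := (exists_length_eq_listLcs x y).choose_spec
  refine weight_le_alignZ hW _ _ x y _ le_rfl h1 h2 ?_
  have h4 := min_count_false_le_listLcs x y
  rw [← h3] at h4
  have h5 := List.count_false_add_count_true x
  have h6 := List.count_false_add_count_true y
  have h7 := List.count_false_add_count_true (exists_length_eq_listLcs x y).choose
  unfold matchedTrue
  omega

theorem matchedTrue_mul_log_le {ε M : ℝ} (h0 : 0 < ε) (hM : 0 < M) (x y : List Bool)
    (h : x.length = y.length) :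
    (matchedTrue x y : ℝ) * (-Real.log ε - 2 * Real.log 8) ≤
      Real.log 8 * ((((x.count true : ℝ) - y.count true) ^ 2 + 1) / 2) +
        ((alignZ (1 / ε) x y).2 / M - 1 + Real.log M) := by
  have h1 := weight_matchedTrue_le_alignZ (W := 1 / ε) (by positivity) x y h
  set Z := (alignZ (1 / ε) x y).2
  set K := matchedTrue x y
  set d := ((x.count true : ℤ) - y.count true).natAbs
  have hZ : 0 < Z := lt_of_lt_of_le (by positivity) h1
  have h2 := Real.log_le_log (by positivity) h1
  rw [Real.log_mul (by positivity) (by positivity), Real.log_pow, Real.log_pow, one_div, one_div,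
    Real.log_inv, Real.log_inv] at h2
  have h3 := Real.log_le_sub_one_of_pos (div_pos hZ hM)
  rw [Real.log_div hZ.ne' hM.ne'] at h3
  have hd : (d : ℝ) = |(x.count true : ℝ) - y.count true| := by
    simp only [d, Nat.cast_natAbs]; push_cast; rfl
  have h4 : (d : ℝ) ≤ (((x.count true : ℝ) - y.count true) ^ 2 + 1) / 2 := by
    rw [hd, ← sq_abs]
    nlinarith [sq_nonneg (|(x.count true : ℝ) - y.count true| - 1)]
  have h5 : 0 < Real.log 8 := Real.log_pos (by norm_num)
  have h6 := mul_le_mul_of_nonneg_left h4 h5.le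
  push_cast at h2
  linarith

theorem bernExp_matchedTrue_mul_le {ε : ℝ} (h0 : 0 < ε) (h1 : ε ≤ 1 / 8) (n : ℕ) :
    bernExp ε n (fun x => bernExp ε n fun y => (matchedTrue x y : ℝ)) *
      (-Real.log ε - 2 * Real.log 8) ≤
      Real.log 8 * (n * ε + 1 / 2) + Real.log 2 + 4 * (n * ε) := by
  have h1' : ε ≤ 1 := by linarith
  set M : ℝ := 2 * (1 + 2 * ε) ^ (n + n)
  have hM : 0 < M := by positivity
  have h2 := bernExp.mono_of_length h0.le h1' (n := n) fun x hx =>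
    bernExp.mono_of_length h0.le h1' (n := n) fun y hy =>
      matchedTrue_mul_log_le h0 hM x y (hx.trans hy.symm)
  have e : ∀ x y : List Bool, Real.log 8 * ((((x.count true : ℝ) - y.count true) ^ 2 + 1) / 2) +
        ((alignZ (1 / ε) x y).2 / M - 1 + Real.log M) =
      (Real.log 8 / 2) * (x.count true : ℝ) ^ 2 + (Real.log 8 / 2) * (y.count true : ℝ) ^ 2 -
        (Real.log 8 * x.count true) * y.count true + (1 / M) * (alignZ (1 / ε) x y).2 +
          (Real.log 8 / 2 - 1 + Real.log M) := fun x y => by ring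
  simp only [e, mul_comm (_ : ℝ) (-Real.log ε - 2 * Real.log 8)] at h2
  simp only [bernExp.add, bernExp.sub, bernExp.mul_left, bernExp.const, bernExp.count_true,
    bernExp.count_true_sq] at h2
  simp only [mul_comm _ ((n : ℝ) * ε)] at h2
  simp only [bernExp.mul_left, bernExp.count_true] at h2
  have h3 := (meanZ_le h0 h1 n n).2
  unfold meanZsnd at h3
  have h4 : 1 / M * bernExp ε n (fun x => bernExp ε n fun y => (alignZ (1 / ε) x y).2) ≤ 1 := by
    rw [one_div, inv_mul_le_iff₀ hM, mul_one]
    exact h3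
  have h5 : Real.log M ≤ Real.log 2 + 4 * (n * ε) := by
    have := Real.log_le_sub_one_of_pos (show 0 < 1 + 2 * ε by linarith)
    rw [Real.log_mul (by norm_num) (by positivity), Real.log_pow]
    push_cast
    have hn : (0 : ℝ) ≤ n := Nat.cast_nonneg n
    nlinarith
  have h6 : 0 < Real.log 8 := Real.log_pos (by norm_num)
  have h7 : 0 ≤ Real.log 8 * (n * ε * ε) := by positivity
  rw [mul_comm]
  linarith

theorem bernExp_matchedTrue_le {ε : ℝ} (h0 : 0 < ε) (h1 : ε < Real.exp (-100)) (n : ℕ) :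
    bernExp ε n (fun x => bernExp ε n fun y => (matchedTrue x y : ℝ)) ≤ 3 / 10 * (n * ε) := by
  have he : Real.exp (-100) ≤ 1 / 8 := by
    rw [Real.exp_neg, one_div]
    refine inv_anti₀ (by norm_num) ?_
    linarith [Real.add_one_le_exp (100 : ℝ)]
  have h1' : ε ≤ 1 := by linarith
  rcases le_total ((n : ℝ) * ε) (1 / 4) with h | h
  · have h2 : bernExp ε n (fun x => bernExp ε n fun y => (matchedTrue x y : ℝ)) ≤
        bernExp ε n (fun x => bernExp ε n fun y => (x.count true : ℝ) * (y.count true : ℝ)) :=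
      bernExp.mono h0.le h1' fun x => bernExp.mono h0.le h1' fun y => by
        exact_mod_cast matchedTrue_le_mul x y
    simp only [bernExp.mul_left, bernExp.count_true, mul_comm _ ((n : ℝ) * ε)] at h2
    have : 0 ≤ (n : ℝ) * ε := by positivity
    nlinarith
  · have h2 := bernExp_matchedTrue_mul_le h0 (by linarith) n
    have h3 : Real.log ε < -100 := (Real.log_lt_iff_lt_exp h0).2 h1
    have h4 : Real.log 8 = 3 * Real.log 2 := by
      rw [show (8 : ℝ) = 2 ^ 3 by norm_num, Real.log_pow]; norm_num
    have h5 := Real.log_two_lt_d9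
    have h6 : Real.log 8 ≤ 2.1 := by rw [h4]; linarith
    set k := bernExp ε n (fun x => bernExp ε n fun y => (matchedTrue x y : ℝ))
    have hk : 0 ≤ k := bernExp.nonneg h0.le h1' fun x => bernExp.nonneg h0.le h1' fun y =>
      Nat.cast_nonneg _
    have h7 : k * 95 ≤ k * (-Real.log ε - 2 * Real.log 8) :=
      mul_le_mul_of_nonneg_left (by linarith) hk
    have h8 : Real.log 8 * (n * ε + 1 / 2) ≤ 2.1 * (n * ε + 1 / 2) :=
      mul_le_mul_of_nonneg_right h6 (by linarith)
    linarith

/-- The mean length of the longest common sublist of random lists of lengths `m` and `n`. -/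
noncomputable def meanLcs (ε : ℝ) (m n : ℕ) : ℝ :=
  bernExp ε m fun x => bernExp ε n fun y => (listLcs x y : ℝ)

theorem meanLcs_comm (ε : ℝ) (m n : ℕ) : meanLcs ε m n = meanLcs ε n m := by
  unfold meanLcs
  rw [bernExp.comm]
  simp only [fun x y : List Bool => listLcs_comm x y]

theorem two_mul_meanLcs_le {ε : ℝ} (h0 : 0 ≤ ε) (h1 : ε ≤ 1) (n : ℕ) :
    2 * meanLcs ε n (n + 1) ≤ meanLcs ε (n + 1) (n + 1) + meanLcs ε n n := by
  have key : ∀ a b : Bool,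
      bernExp ε n (fun x => bernExp ε n fun y => (listLcs x (b :: y) : ℝ)) +
        bernExp ε n (fun x => bernExp ε n fun y => (listLcs (x ++ [a]) y : ℝ)) ≤
      bernExp ε n (fun x => bernExp ε n fun y => (listLcs (x ++ [a]) (b :: y) : ℝ)) +
        bernExp ε n (fun x => bernExp ε n fun y => (listLcs x y : ℝ)) := by
    intro a b
    simp only [← bernExp.add]
    exact bernExp.mono h0 h1 fun x => bernExp.mono h0 h1 fun y => by
      exact_mod_cast listLcs_monge a b x y
  rw [two_mul]
  nth_rw 2 [meanLcs_comm]
  unfold meanLcs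
  rw [bernExp.succ_append n (fun x => bernExp ε n fun y => (listLcs x y : ℝ)),
    bernExp.succ_append n (fun x => bernExp ε (n + 1) fun y => (listLcs x y : ℝ))]
  simp only [bernExp.succ, bernExp.add, bernExp.mul_left]
  have h2 : 0 ≤ 1 - ε := by linarith
  have k1 := mul_le_mul_of_nonneg_left (key true true) (mul_nonneg h0 h0)
  have k2 := mul_le_mul_of_nonneg_left (key true false) (mul_nonneg h0 h2)
  have k3 := mul_le_mul_of_nonneg_left (key false true) (mul_nonneg h2 h0)
  have k4 := mul_le_mul_of_nonneg_left (key false false) (mul_nonneg h2 h2)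
  linarith

theorem meanLcs_succ_succ_ge {ε : ℝ} (h0 : 0 ≤ ε) (h1 : ε ≤ 1) (n : ℕ) :
    meanLcs ε n n + (1 - 2 * ε) ≤ meanLcs ε (n + 1) (n + 1) := by
  have key : ∀ a b : Bool,
      bernExp ε n (fun x => bernExp ε n fun y => (listLcs x y : ℝ)) + (if a = b then 1 else 0) ≤
      bernExp ε n (fun x => bernExp ε n fun y => (listLcs (a :: x) (b :: y) : ℝ)) := by
    intro a b
    have : ∀ f : List Bool → List Bool → ℝ,
        bernExp ε n (fun x => bernExp ε n fun y => f x y) + (if a = b then 1 else 0) =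
        bernExp ε n (fun x => bernExp ε n fun y => f x y + (if a = b then 1 else 0)) := by
      intro f; simp only [bernExp.add, bernExp.const]
    rw [this]
    refine bernExp.mono h0 h1 fun x => bernExp.mono h0 h1 fun y => ?_
    split_ifs with h
    · subst h
      exact_mod_cast listLcs_add_one_le a x y
    · rw [add_zero]
      exact_mod_cast listLcs_mono (List.sublist_cons_self a x) (List.sublist_cons_self b y)
  unfold meanLcs
  simp only [bernExp.succ, bernExp.add, bernExp.mul_left]
  have h2 : 0 ≤ 1 - ε := by linarith
  have k1 := mul_le_mul_of_nonneg_left (key true true) (mul_nonneg h0 h0)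
  have k2 := mul_le_mul_of_nonneg_left (key true false) (mul_nonneg h0 h2)
  have k3 := mul_le_mul_of_nonneg_left (key false true) (mul_nonneg h2 h0)
  have k4 := mul_le_mul_of_nonneg_left (key false false) (mul_nonneg h2 h2)
  simp only [if_true, if_false, Bool.true_eq_false, Bool.false_eq_true] at k1 k2 k3 k4
  nlinarith [sq_nonneg ε]

/-- Shortening one of two lists of equal length costs almost half a letter. -/
theorem meanLcs_le_sub {ε : ℝ} (h0 : 0 ≤ ε) (h1 : ε ≤ 1) (n : ℕ) :
    meanLcs ε n (n + 1) ≤ meanLcs ε (n + 1) (n + 1) - (1 / 2 - ε) := by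
  have h2 := two_mul_meanLcs_le h0 h1 n
  have h3 := meanLcs_succ_succ_ge h0 h1 n
  linarith

/-- The covariance of the number of letters `true` of one list with the length of the longest
common sublist is negative of linear order. -/
theorem covariance_count_listLcs_le {ε : ℝ} (h0 : 0 < ε) (h1 : ε < Real.exp (-100)) (n : ℕ) :
    bernExp ε n (fun x => bernExp ε n fun y => (x.count true : ℝ) * listLcs x y) -
      n * ε * meanLcs ε n n ≤ -(n * ε / 10) := by
  cases n with
  | zero => simp [bernExp.zero]
  | succ n =>
    have he : Real.exp (-100) ≤ 1 / 10 := by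
      rw [Real.exp_neg, one_div]
      refine inv_anti₀ (by norm_num) ?_
      linarith [Real.add_one_le_exp (100 : ℝ)]
    have h1' : ε ≤ 1 := by linarith
    have h2 : bernExp ε (n + 1) (fun x => bernExp ε (n + 1) fun y =>
        (x.count true : ℝ) * listLcs x y - matchedTrue x y) ≤ _ :=
      bernExp.mono h0.le h1' fun x => bernExp.mono h0.le h1' fun y =>
        count_mul_listLcs_sub_le x y
    rw [bernExp.comm (f := fun x y => eraseTrueSum (fun x' => (listLcs x' y : ℝ)) x)] at h2
    simp only [bernExp.eraseTrueSum, bernExp.mul_left, bernExp.sub] at h2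
    rw [← bernExp.comm (f := fun x y => (listLcs x y : ℝ))] at h2
    have h3 := bernExp_matchedTrue_le h0 h1 (n + 1)
    have h4 := meanLcs_le_sub h0.le h1' n
    have h5 : 0 ≤ ((n : ℝ) + 1) * ε := by positivity
    have h6 := mul_le_mul_of_nonneg_left h4 h5
    have h7 := mul_le_mul_of_nonneg_left (show ε ≤ 1 / 10 by linarith) h5
    simp only [bernExp.mul_left]
    change _ ≤ ((n : ℝ) + 1) * (ε * meanLcs ε n (n + 1)) at h2
    push_cast at h3 ⊢
    linarith

/-- The variance of the length of the longest common sublist of two random lists. -/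
noncomputable def varLcs (ε : ℝ) (n : ℕ) : ℝ :=
  bernExp ε n (fun x => bernExp ε n fun y => (listLcs x y : ℝ) ^ 2) - meanLcs ε n n ^ 2

theorem le_varLcs {ε : ℝ} (h0 : 0 < ε) (h1 : ε < Real.exp (-100)) (n : ℕ) :
    ε / 100 * n ≤ varLcs ε n := by
  have h1' : ε ≤ 1 := h1.le.trans (Real.exp_le_one_iff.2 (by norm_num))
  have hc := covariance_count_listLcs_le h0 h1 n
  have hs := bernExp.mul_sq_le h0.le h1' n n (fun x _ => (x.count true : ℝ) - n * ε)
    (fun x y => (listLcs x y : ℝ) - meanLcs ε n n)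
  have e1 : bernExp ε n (fun x => bernExp ε n fun y =>
      ((x.count true : ℝ) - n * ε) * ((listLcs x y : ℝ) - meanLcs ε n n)) =
      bernExp ε n (fun x => bernExp ε n fun y => (x.count true : ℝ) * listLcs x y) -
      n * ε * meanLcs ε n n := by
    have : ∀ x y : List Bool,
      ((x.count true : ℝ) - n * ε) * ((listLcs x y : ℝ) - meanLcs ε n n) =
      (x.count true : ℝ) * listLcs x y - n * ε * listLcs x y - meanLcs ε n n * x.count true
        + meanLcs ε n n * (n * ε) := fun x y => by ring
    simp only [this, bernExp.add, bernExp.sub, bernExp.mul_left _ (fun x => (listLcs _ x : ℝ)),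
      bernExp.mul_left (n * ε), bernExp.const, bernExp.mul_left (meanLcs ε n n),
      bernExp.count_true]
    change _ - _ * meanLcs ε n n - _ + _ = _
    ring
  have e2 : bernExp ε n (fun x => bernExp ε n fun _ => ((x.count true : ℝ) - n * ε) ^ 2) =
      n * ε * (1 - ε) := by
    have : ∀ x : List Bool, ((x.count true : ℝ) - n * ε) ^ 2 =
      (x.count true : ℝ) ^ 2 - (2 * (n * ε)) * x.count true + (n * ε) ^ 2 := fun x => by ring
    simp only [bernExp.const, this, bernExp.add, bernExp.sub, bernExp.mul_left,
      bernExp.count_true, bernExp.count_true_sq]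
    ring
  have e3 : bernExp ε n (fun x => bernExp ε n fun y =>
      ((listLcs x y : ℝ) - meanLcs ε n n) ^ 2) = varLcs ε n := by
    have : ∀ x y : List Bool, ((listLcs x y : ℝ) - meanLcs ε n n) ^ 2 =
      (listLcs x y : ℝ) ^ 2 - (2 * meanLcs ε n n) * listLcs x y + meanLcs ε n n ^ 2 :=
      fun x y => by ring
    simp only [this, bernExp.add, bernExp.sub, bernExp.mul_left, bernExp.const]
    change _ - _ * meanLcs ε n n + _ = _
    unfold varLcs
    ring
  have hV : 0 ≤ varLcs ε n := e3 ▸ bernExp.nonneg h0.le h1' fun x =>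
    bernExp.nonneg h0.le h1' fun y => sq_nonneg _
  rw [e1, e2, e3] at hs
  rcases Nat.eq_zero_or_pos n with rfl | hn
  · simpa using hV
  · have hn' : 0 < (n : ℝ) := Nat.cast_pos.2 hn
    have hp : 0 < (n : ℝ) * ε := by positivity
    have h2 : (n * ε / 10) ^ 2 ≤ n * ε * (1 - ε) * varLcs ε n := by
      refine le_trans ?_ hs
      rw [← neg_sq (_ - _)]
      exact pow_le_pow_left₀ (by positivity) (by linarith) 2
    have h3 : 0 ≤ n * ε * ε * varLcs ε n := by positivity
    have h4 : n * ε * (n * ε / 100) ≤ n * ε * varLcs ε n := by linarith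
    linarith [le_of_mul_le_mul_left h4 hp]

theorem varLcs_le {ε : ℝ} (h0 : 0 ≤ ε) (h1 : ε ≤ 1) (n : ℕ) :
    varLcs ε n ≤ 2 * ε * (1 - ε) * n := by
  have h2 : bernExp ε n (fun x => bernExp ε n fun y => (listLcs x y : ℝ) ^ 2) ≤
      bernExp ε n (fun x => bernExp ε n (fun y => (listLcs x y : ℝ)) ^ 2 + n * (ε * (1 - ε))) :=
    bernExp.mono h0 h1 fun x => bernExp.variance_le h0 h1 _ fun y₁ y₂ b b' => by
      rw [listLcs_comm x, listLcs_comm x]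
      exact_mod_cast listLcs_substitution_le y₁ y₂ x b b'
  have h3 := bernExp.variance_le (n := n) h0 h1
    (fun x => bernExp ε n (fun y => (listLcs x y : ℝ))) fun x₁ x₂ b b' => by
      rw [← bernExp.const (ε := ε) (n := n) 1, ← bernExp.add]
      exact bernExp.mono h0 h1 fun y => by
        exact_mod_cast listLcs_substitution_le x₁ x₂ y b b'
  rw [bernExp.add, bernExp.const] at h2
  unfold varLcs meanLcs
  linarith

theorem bernExp_eq_sum (ε : ℝ) (n : ℕ) (f : List Bool → ℝ) :
    bernExp ε n f = ∑ x : Fin n → Bool, (∏ i, if x i then ε else 1 - ε) * f (List.ofFn x) := by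
  induction n generalizing f with
  | zero => simp [bernExp.zero]
  | succ n ih =>
    rw [bernExp.succ, ih, ih, ← (Fin.consEquiv fun _ : Fin (n + 1) => Bool).sum_comp,
      Fintype.sum_prod_type, Fintype.sum_bool, Finset.mul_sum, Finset.mul_sum]
    congr 1 <;>
    · refine Finset.sum_congr rfl fun x _ => ?_
      simp [Fin.consEquiv, Fin.prod_univ_succ, List.ofFn_succ, mul_assoc]

section Transfer

variable {Ω : Type*} [MeasurableSpace Ω] {P : Measure Ω} [IsProbabilityMeasure P] {ε : ℝ}

theorem map_fin_real_singleton {X : ℕ → Ω → Bool} (hm : ∀ i, Measurable (X i))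
    (hp : ∀ i, P.real {ω | X i ω = true} = ε) (hi : iIndepFun X P) {n : ℕ} (x : Fin n → Bool) :
    (P.map fun ω (i : Fin n) => X i ω).real {x} = ∏ i, if x i then ε else 1 - ε := by
  have h1 : iIndepFun (fun i : Fin n => X i) P := hi.precomp Fin.val_injective
  rw [iIndepFun.map_fun_eq_pi_map (fun i : Fin n => (hm i).aemeasurable) h1]
  have : ∀ i : Fin n, IsProbabilityMeasure (P.map (X i)) := fun i =>
    Measure.isProbabilityMeasure_map (hm i).aemeasurable
  rw [measureReal_def, Measure.pi_singleton, ENNReal.toReal_prod]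
  refine Finset.prod_congr rfl fun i _ => ?_
  rw [← measureReal_def, map_measureReal_apply (hm i) (measurableSet_singleton _)]
  cases x i with
  | true => exact hp i
  | false =>
    have : X i ⁻¹' {false} = {ω | X i ω = true}ᶜ := by ext ω; simp
    have hs : MeasurableSet {ω | X i ω = true} := hm i (measurableSet_singleton true)
    rw [this, probReal_compl_eq_one_sub hs, hp i]
    simp

theorem IndepBernoulliSeqs.integral_eq {X Y : ℕ → Ω → Bool} (h : IndepBernoulliSeqs P ε X Y)
    (n : ℕ) (f : List Bool → List Bool → ℝ) :
    ∫ ω, f (List.ofFn fun i : Fin n => X i ω) (List.ofFn fun i : Fin n => Y i ω) ∂P =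
      bernExp ε n fun x => bernExp ε n fun y => f x y := by
  set XF : Ω → Fin n → Bool := fun ω i => X i ω
  set YF : Ω → Fin n → Bool := fun ω i => Y i ω
  have hX : Measurable XF := measurable_pi_lambda _ fun i => h.measurable_left i
  have hY : Measurable YF := measurable_pi_lambda _ fun i => h.measurable_right i
  have hXY : IndepFun XF YF P := by
    have hr : Measurable fun (z : ℕ → Bool) (i : Fin n) => z i :=
      measurable_pi_lambda _ fun i => measurable_pi_apply _
    exact h.indep.comp hr hr
  have : IsProbabilityMeasure (P.map XF) := Measure.isProbabilityMeasure_map hX.aemeasurable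
  have : IsProbabilityMeasure (P.map YF) := Measure.isProbabilityMeasure_map hY.aemeasurable
  have e : ∫ ω, f (List.ofFn (XF ω)) (List.ofFn (YF ω)) ∂P =
      ∫ z, f (List.ofFn z.1) (List.ofFn z.2) ∂((P.map XF).prod (P.map YF)) := by
    rw [← hXY.map_prod_eq_prod_map_map hX.aemeasurable hY.aemeasurable,
      integral_map (hX.prodMk hY).aemeasurable (measurable_of_finite _).aestronglyMeasurable]
  rw [e, integral_fintype (.of_finite), Fintype.sum_prod_type, bernExp_eq_sum]
  refine Finset.sum_congr rfl fun x _ => ?_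
  rw [bernExp_eq_sum, Finset.mul_sum]
  refine Finset.sum_congr rfl fun y _ => ?_
  rw [← Set.singleton_prod_singleton, measureReal_prod_prod,
    map_fin_real_singleton h.measurable_left h.prob_left h.indep_left,
    map_fin_real_singleton h.measurable_right h.prob_right h.indep_right, smul_eq_mul, mul_assoc]

theorem IndepBernoulliSeqs.variance_eq {X Y : ℕ → Ω → Bool} (h : IndepBernoulliSeqs P ε X Y)
    (n : ℕ) : variance (lcsVar X Y n) P = varLcs ε n := by
  have hX : Measurable fun ω (i : Fin n) => X i ω :=
    measurable_pi_lambda _ fun i => h.measurable_left i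
  have hY : Measurable fun ω (i : Fin n) => Y i ω :=
    measurable_pi_lambda _ fun i => h.measurable_right i
  have hm : Measurable (lcsVar X Y n) :=
    (measurable_of_finite fun z : (Fin n → Bool) × (Fin n → Bool) =>
      (lcsLength z.1 z.2 : ℝ)).comp (hX.prodMk hY)
  have hb : ∀ ω, ‖lcsVar X Y n ω‖ ≤ n := fun ω => by
    obtain ⟨w, h1, -, h3⟩ := exists_length_eq_listLcs (List.ofFn fun i : Fin n => X i ω)
      (List.ofFn fun i : Fin n => Y i ω)
    have := h1.length_le
    rw [List.length_ofFn, h3, ← lcsLength_eq_listLcs] at this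
    rw [lcsVar, Real.norm_natCast]
    exact_mod_cast this
  rw [variance_eq_sub (MemLp.of_bound hm.aestronglyMeasurable n (ae_of_all _ hb))]
  have e : ∀ ω, lcsVar X Y n ω = (listLcs (List.ofFn fun i : Fin n => X i ω)
      (List.ofFn fun i : Fin n => Y i ω) : ℝ) := fun ω => by
    rw [lcsVar, lcsLength_eq_listLcs]
  simp only [Pi.pow_apply, e]
  rw [h.integral_eq n fun x y => (listLcs x y : ℝ),
    h.integral_eq n fun x y => (listLcs x y : ℝ) ^ 2]
  rfl

end Transfer

theorem isTheta_of_linear_bounds {v : ℕ → ℝ} {c C : ℝ} (hc : 0 < c)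
    (h1 : ∀ n : ℕ, c * n ≤ v n) (h2 : ∀ n : ℕ, v n ≤ C * n) :
    v =Θ[atTop] (fun n : ℕ => (n : ℝ)) ∧
      (fun n : ℕ => Real.sqrt (v n)) =Θ[atTop] (fun n : ℕ => Real.sqrt (n : ℝ)) := by
  have h0 : ∀ n : ℕ, 0 ≤ v n := fun n => (by positivity : 0 ≤ c * (n : ℝ)).trans (h1 n)
  have hC : 0 ≤ C := by simpa using (h0 1).trans (h2 1)
  refine ⟨⟨.of_bound C (.of_forall fun n => ?_), .of_bound c⁻¹ (.of_forall fun n => ?_)⟩,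
    ⟨.of_bound (Real.sqrt C) (.of_forall fun n => ?_),
      .of_bound (Real.sqrt c⁻¹) (.of_forall fun n => ?_)⟩⟩
  · rw [Real.norm_of_nonneg (h0 n), Real.norm_natCast]
    exact h2 n
  · rw [Real.norm_of_nonneg (h0 n), Real.norm_natCast, inv_mul_eq_div, le_div_iff₀' hc]
    exact h1 n
  · rw [Real.norm_of_nonneg (Real.sqrt_nonneg _), Real.norm_of_nonneg (Real.sqrt_nonneg _),
      ← Real.sqrt_mul hC]
    exact Real.sqrt_le_sqrt (h2 n)
  · rw [Real.norm_of_nonneg (Real.sqrt_nonneg _), Real.norm_of_nonneg (Real.sqrt_nonneg _),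
      ← Real.sqrt_mul (inv_nonneg.2 hc.le)]
    refine Real.sqrt_le_sqrt ?_
    rw [inv_mul_eq_div, le_div_iff₀' hc]
    exact h1 n

theorem theorem2p1 :
    ∃ ε₀ : ℝ, 0 < ε₀ ∧ ε₀ ≤ 1 / 2 ∧ ∀ ε : ℝ, 0 < ε → ε < ε₀ →
      ∃ c : ℝ, 0 < c ∧
        ∀ (Ω : Type*) [MeasurableSpace Ω] (P : Measure Ω) [IsProbabilityMeasure P]
          (X Y : ℕ → Ω → Bool), IndepBernoulliSeqs P ε X Y →
          (∀ n : ℕ, c * (n : ℝ) ≤ variance (lcsVar X Y n) P) ∧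
          (∀ n : ℕ, variance (lcsVar X Y n) P ≤ 2 * ε * (1 - ε) * (n : ℝ)) ∧
          (fun n : ℕ => variance (lcsVar X Y n) P) =Θ[atTop] (fun n : ℕ => (n : ℝ)) ∧
          (fun n : ℕ => Real.sqrt (variance (lcsVar X Y n) P)) =Θ[atTop]
            (fun n : ℕ => Real.sqrt (n : ℝ)) := by
  refine ⟨Real.exp (-100), Real.exp_pos _, ?_, fun ε h0 h1 => ⟨ε / 100, by positivity, ?_⟩⟩
  · rw [Real.exp_neg, one_div]
    refine inv_anti₀ (by norm_num) ?_
    linarith [Real.add_one_le_exp (100 : ℝ)]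
  · intro Ω _ P _ X Y h
    simp only [h.variance_eq]
    have hl := le_varLcs h0 h1
    have hu := varLcs_le h0.le (h1.le.trans (Real.exp_le_one_iff.2 (by norm_num)))
    exact ⟨hl, hu, isTheta_of_linear_bounds (by positivity) hl hu⟩
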